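/- For an open interval $\Omega\subset\mathbf R$ and $\mathbf K\in\{\mathbf R,\mathbf C\}$ let $H^1(\Omega,\mathbf K)$ be the space of functions $f\in L^2(\Omega,\mathbf K)$ whose distributional derivative $f_x$ belongs to $L^2(\Omega,\mathbf K)$, with the norm $\|f\| := \big(\int_\Omega |f|^2\,dx+\int_\Omega |f_x|^2\,dx\big)^{1/2}$. Let $H^1_0(0,\pi)$ be the space of real functions $f\in H^1((0,\pi),\mathbf R)$ whose continuous representative on $[0,\pi]$ satisfies $f(0)=f(\pi)=0$, with the same norm. Both $H^1_0(0,\pi)$ and $H^1(\mathbf R,\mathbf C)$ are closed under the pointwise product, there exist minimal (i.e. sharp) real constants $L$ and $M$ in the inequalities $$\|fg\|\le L\,\|f\|\,\|g\|\quad\text{for all } f,g\in H^1_0(0,\pi),\qquad \|fg\|\le M\,\|f\|\,\|g\|\quad\text{for all } f,g\in H^1(\mathbf R,\mathbf C),$$ and these constants satisfy $$0.811< L\le M\le 1 .$$ -/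

import Mathlib

open MeasureTheory Set
open scoped ContDiff

/-- `f'` is the weak (distributional) derivative of `f` on the open set `Ω ⊆ ℝ`:
both are locally integrable on `Ω`, and `∫_Ω φ' f = - ∫_Ω φ f'` for every smooth real test function
`φ` with compact support in `Ω`. Values outside `Ω` play no role. -/
def IsWeakDeriv {𝕜 : Type*} [RCLike 𝕜] (Ω : Set ℝ) (f f' : ℝ → 𝕜) : Prop :=
  LocallyIntegrableOn f Ω volume ∧ LocallyIntegrableOn f' Ω volume ∧
    ∀ φ : ℝ → ℝ, ContDiff ℝ ∞ φ → HasCompactSupport φ → tsupport φ ⊆ Ω →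
      ∫ x in Ω, deriv φ x • f x = - ∫ x in Ω, φ x • f' x

/-- The weak derivative on an open set is unique up to a null set. -/
theorem IsWeakDeriv.ae_eq {𝕜 : Type*} [RCLike 𝕜] {Ω : Set ℝ} (hΩ : IsOpen Ω) {f g h : ℝ → 𝕜}
    (hg : IsWeakDeriv Ω f g) (hh : IsWeakDeriv Ω f h) : g =ᵐ[volume.restrict Ω] h := by
  have key : ∀ᵐ x ∂(volume : Measure ℝ), x ∈ Ω → (g - h) x = 0 := by
    refine hΩ.ae_eq_zero_of_integral_contDiff_smul_eq_zero (hg.2.1.sub hh.2.1) ?_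
    intro φ hφ hc hs
    have hint : ∀ k : ℝ → 𝕜, LocallyIntegrableOn k Ω volume →
        IntegrableOn (fun x => φ x • k x) Ω volume := by
      intro k hk
      have h1 : IntegrableOn k (tsupport φ) volume := hk.integrableOn_compact_subset hs hc
      have h2 : IntegrableOn (fun x => φ x • k x) (tsupport φ) volume :=
        h1.continuousOn_smul hφ.continuous.continuousOn hc
      have h3 : Integrable (fun x => φ x • k x) volume := by
        rw [← integrableOn_iff_integrable_of_support_subset (s := tsupport φ)]
        · exact h2
        · intro x hx
          apply subset_tsupport
          intro h0
          exact hx (by simp [h0])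
      exact h3.integrableOn
    have e : ∫ x in Ω, φ x • g x = ∫ x in Ω, φ x • h x :=
      neg_injective ((hg.2.2 φ hφ hc hs).symm.trans (hh.2.2 φ hφ hc hs))
    have hset : ∫ x, φ x • (g - h) x = ∫ x in Ω, φ x • (g - h) x := by
      refine (setIntegral_eq_integral_of_forall_compl_eq_zero ?_).symm
      intro x hx
      have : φ x = 0 := image_eq_zero_of_notMem_tsupport (fun h' => hx (hs h'))
      simp [this]
    rw [hset]
    simp only [Pi.sub_apply, smul_sub]
    rw [integral_sub (hint g hg.2.1) (hint h hh.2.1), e, sub_self]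
  rw [Filter.EventuallyEq, ae_restrict_iff' hΩ.measurableSet]
  filter_upwards [key] with x hx hxΩ
  exact sub_eq_zero.mp (hx hxΩ)

open Classical in
/-- The weak derivative `f_x` of `f` on `Ω` (a representative; `0` if there is none). -/
noncomputable def weakDeriv {𝕜 : Type*} [RCLike 𝕜] (Ω : Set ℝ) (f : ℝ → 𝕜) : ℝ → 𝕜 :=
  if h : ∃ f', IsWeakDeriv Ω f f' then h.choose else 0

/-- The Sobolev space `H¹(Ω, 𝕜)`: functions in `L²(Ω)` with weak derivative in `L²(Ω)`. Its members
are representatives; the norm below only sees them up to null sets. -/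
def H1 {𝕜 : Type*} [RCLike 𝕜] (Ω : Set ℝ) : Set (ℝ → 𝕜) :=
  {f | MemLp f 2 (volume.restrict Ω) ∧
    ∃ f', IsWeakDeriv Ω f f' ∧ MemLp f' 2 (volume.restrict Ω)}

/-- The norm `‖f‖ = (‖f‖²_{L²(Ω)} + ‖f_x‖²_{L²(Ω)})^{1/2}` of `f ∈ H¹(Ω, 𝕜)`. -/
noncomputable def h1Norm {𝕜 : Type*} [RCLike 𝕜] (Ω : Set ℝ) (f : ℝ → 𝕜) : ℝ :=
  Real.sqrt ((∫ x in Ω, ‖f x‖ ^ 2) + ∫ x in Ω, ‖weakDeriv Ω f x‖ ^ 2)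

/-- The real space `H¹₀(a, b)`: members of `H¹(a, b)` whose representative that is continuous on
`[a, b]` vanishes at `a` and at `b`. -/
def H10 (a b : ℝ) : Set (ℝ → ℝ) :=
  {f | f ∈ H1 (Ioo a b) ∧
    ∃ u : ℝ → ℝ, ContinuousOn u (Icc a b) ∧ f =ᵐ[volume.restrict (Ioo a b)] u ∧ u a = 0 ∧ u b = 0}

/-- `C` is a constant for the product inequality `‖f g‖ ≤ C ‖f‖ ‖g‖` on the space `X` of functions
on `Ω`. -/
def IsProductConstant {𝕜 : Type*} [RCLike 𝕜] (Ω : Set ℝ) (X : Set (ℝ → 𝕜)) (C : ℝ) : Prop :=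
  ∀ f ∈ X, ∀ g ∈ X, h1Norm Ω (f * g) ≤ C * h1Norm Ω f * h1Norm Ω g

open Filter Topology

/-! The bound `M ≤ 1` is proved on absolutely continuous representatives f, g with derivatives f',
g'. Put a = |f|² + |f'|² and b = |g|² + |g'|². Since (|f|²)' = 2 Re(conj f · f') and |f|² is
integrable with integrable derivative, it vanishes at ±∞. Completing the square on a right half-line
gives ∫_x^∞ a = |f(x)|² + ∫_x^∞ |f + f'|², while the left half-line gives |f(x)|² ≤ ∫_{-∞}^x a;
likewise for g. Splitting the plane along its diagonal, ∫a · ∫b = ∫ a(x) ∫_x^∞ b + ∫ b(y) ∫_y^∞ a.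
Inserting the identity, swapping the order of integration and using the left half-line bound yields
the lower bound ∫ (a|g|² + |g + g'|²|f|² + b|f|² + |f + f'|²|g|²). Its cross terms sum to (|fg|²)',
which integrates to zero; what remains is 4|fg|² + 2|f'g|² + 2|fg'|² ≥ |fg|² + |(fg)'|². This is
`IsPrimitive.integral_mul_le`. Extension by zero embeds H¹₀(0, π) in H¹(ℝ, ℂ) isometrically and
multiplicatively, so `L ≤ M`. The lower bound for `L` comes from one trial function, f = g = t + t⁵
with t the tent on [0, π], for which ‖f²‖ / ‖f‖² is about 0.829. Minimal constants exist because the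
admissible constants form a nonempty closed set bounded below. -/

/-- `u` is a primitive on `ℝ` of the locally integrable function `v`. -/
def IsPrimitive {𝕜 : Type*} [RCLike 𝕜] (u v : ℝ → 𝕜) : Prop :=
  LocallyIntegrable v volume ∧ ∀ x y, u y - u x = ∫ t in x..y, v t

/-! ### Calculus of primitives and their weak derivatives -/

section IsPrimitive

variable {𝕜 : Type*} [RCLike 𝕜]

theorem MeasureTheory.LocallyIntegrable.intervalIntegrable {v : ℝ → 𝕜}
    (hv : LocallyIntegrable v volume) (x y : ℝ) : IntervalIntegrable v volume x y :=
  intervalIntegrable_iff.mpr <|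
    (hv.integrableOn_isCompact isCompact_uIcc).mono_set uIoc_subset_uIcc

theorem LocallyIntegrable.of_intervalIntegrable {v : ℝ → 𝕜}
    (hv : ∀ x y, IntervalIntegrable v volume x y) : LocallyIntegrable v volume := by
  intro x
  refine ⟨Ioc (x - 1) (x + 1), Ioc_mem_nhds (by linarith) (by linarith), ?_⟩
  exact (intervalIntegrable_iff_integrableOn_Ioc_of_le (by linarith)).mp (hv _ _)

theorem IsPrimitive.continuous {u v : ℝ → 𝕜} (h : IsPrimitive u v) : Continuous u := by
  have e : u = fun x => u 0 + ∫ t in (0 : ℝ)..x, v t := by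
    funext x
    rw [← h.2 0 x]; ring
  rw [e]
  exact continuous_const.add
    (intervalIntegral.continuous_primitive h.1.intervalIntegrable 0)

theorem IsPrimitive.of_locallyIntegrable {v : ℝ → 𝕜} (hv : LocallyIntegrable v volume)
    (a : ℝ) (c : 𝕜) : IsPrimitive (fun x => c + ∫ t in a..x, v t) v := by
  refine ⟨hv, fun x y => ?_⟩
  rw [← intervalIntegral.integral_interval_sub_left (hv.intervalIntegrable a y)
    (hv.intervalIntegrable a x)]
  ring

theorem IsPrimitive.add {u v u' v' : ℝ → 𝕜} (h : IsPrimitive u v) (h' : IsPrimitive u' v') :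
    IsPrimitive (fun x => u x + u' x) (fun x => v x + v' x) := by
  refine ⟨h.1.add h'.1, fun x y => ?_⟩
  rw [intervalIntegral.integral_add (h.1.intervalIntegrable x y) (h'.1.intervalIntegrable x y),
    ← h.2, ← h'.2]
  ring

theorem IsPrimitive.sub {u v u' v' : ℝ → 𝕜} (h : IsPrimitive u v) (h' : IsPrimitive u' v') :
    IsPrimitive (fun x => u x - u' x) (fun x => v x - v' x) := by
  refine ⟨h.1.sub h'.1, fun x y => ?_⟩
  rw [intervalIntegral.integral_sub (h.1.intervalIntegrable x y) (h'.1.intervalIntegrable x y),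
    ← h.2, ← h'.2]
  ring

theorem IsPrimitive.comp_clm {𝕜' : Type*} [RCLike 𝕜'] (T : 𝕜 →L[ℝ] 𝕜') {u v : ℝ → 𝕜}
    (h : IsPrimitive u v) : IsPrimitive (fun x => T (u x)) (fun x => T (v x)) := by
  refine ⟨LocallyIntegrable.of_intervalIntegrable fun x y => ?_, fun x y => ?_⟩
  · exact ⟨T.integrable_comp (h.1.intervalIntegrable x y).1,
      T.integrable_comp (h.1.intervalIntegrable x y).2⟩
  · rw [T.intervalIntegral_comp_comm (h.1.intervalIntegrable x y), ← h.2, map_sub]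

theorem IsPrimitive.absolutelyContinuousOnInterval {u v : ℝ → ℝ} (h : IsPrimitive u v)
    (x y : ℝ) : AbsolutelyContinuousOnInterval u x y := by
  have e : u = fun z => u x + ∫ t in x..z, v t := by
    funext z
    rw [← h.2 x z]; ring
  rw [e]
  refine AbsolutelyContinuousOnInterval.add ?_
    ((h.1.intervalIntegrable x y).absolutelyContinuousOnInterval_intervalIntegral left_mem_uIcc)
  exact contDiff_const.contDiffOn.absolutelyContinuousOnInterval

theorem IsPrimitive.ae_hasDerivAt {u v : ℝ → 𝕜} (h : IsPrimitive u v) :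
    ∀ᵐ x, HasDerivAt u (v x) x := by
  have e : u = fun z => u 0 + ∫ t in (0 : ℝ)..z, v t := by
    funext z
    rw [← h.2 0 z]; ring
  filter_upwards [LocallyIntegrable.ae_hasDerivAt_integral h.1] with x hx
  rw [e]
  exact (hx 0).const_add _

theorem IsPrimitive.locallyIntegrable_mul {u v u' v' : ℝ → 𝕜} (h : IsPrimitive u v)
    (h' : IsPrimitive u' v') :
    LocallyIntegrable (fun x => v x * u' x + u x * v' x) volume :=
  LocallyIntegrable.of_intervalIntegrable fun x y =>
    ((h.1.intervalIntegrable x y).mul_continuousOn h'.continuous.continuousOn).add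
      ((h'.1.intervalIntegrable x y).continuousOn_mul h.continuous.continuousOn)

/-- Primitives are absolutely continuous, so integration by parts holds; Lebesgue differentiation
identifies the almost everywhere derivatives. -/
theorem IsPrimitive.mul_real {u v u' v' : ℝ → ℝ} (h : IsPrimitive u v)
    (h' : IsPrimitive u' v') :
    IsPrimitive (fun x => u x * u' x) (fun x => v x * u' x + u x * v' x) := by
  refine ⟨h.locallyIntegrable_mul h', fun x y => ?_⟩
  rw [← (h.absolutelyContinuousOnInterval x y).integral_deriv_mul_eq_sub
    (h'.absolutelyContinuousOnInterval x y)]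
  refine intervalIntegral.integral_congr_ae ?_
  filter_upwards [h.ae_hasDerivAt, h'.ae_hasDerivAt] with t ht ht' _
  rw [ht.deriv, ht'.deriv]

theorem IsPrimitive.re {u v : ℝ → 𝕜} (h : IsPrimitive u v) :
    IsPrimitive (fun x => RCLike.re (u x)) (fun x => RCLike.re (v x)) :=
  h.comp_clm RCLike.reCLM

theorem IsPrimitive.im {u v : ℝ → 𝕜} (h : IsPrimitive u v) :
    IsPrimitive (fun x => RCLike.im (u x)) (fun x => RCLike.im (v x)) :=
  h.comp_clm RCLike.imCLM

theorem IsPrimitive.conj {u v : ℝ → 𝕜} (h : IsPrimitive u v) :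
    IsPrimitive (fun x => starRingEnd 𝕜 (u x)) (fun x => starRingEnd 𝕜 (v x)) :=
  h.comp_clm (RCLike.conjCLE : 𝕜 ≃L[ℝ] 𝕜).toContinuousLinearMap

theorem IsPrimitive.ofReal {u v : ℝ → ℝ} (h : IsPrimitive u v) :
    IsPrimitive (fun x => (u x : 𝕜)) (fun x => (v x : 𝕜)) :=
  h.comp_clm (RCLike.ofRealCLM : ℝ →L[ℝ] 𝕜)

/-- Real and imaginary parts are primitives, so the real product rule applies to each term of the
product. -/
theorem IsPrimitive.mul {u v u' v' : ℝ → 𝕜} (h : IsPrimitive u v) (h' : IsPrimitive u' v') :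
    IsPrimitive (fun x => u x * u' x) (fun x => v x * u' x + u x * v' x) := by
  have hL := h.locallyIntegrable_mul h'
  refine ⟨hL, fun x y => ?_⟩
  have hre := ((h.re.mul_real h'.re).sub (h.im.mul_real h'.im)).2 x y
  have him := ((h.re.mul_real h'.im).add (h.im.mul_real h'.re)).2 x y
  have cre := (RCLike.reCLM (K := 𝕜)).intervalIntegral_comp_comm (hL.intervalIntegrable x y)
  have cim := (RCLike.imCLM (K := 𝕜)).intervalIntegral_comp_comm (hL.intervalIntegrable x y)
  simp only [RCLike.reCLM_apply, RCLike.imCLM_apply] at cre cim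
  refine RCLike.ext ?_ ?_
  · rw [← cre]
    simp only [map_sub, map_add, RCLike.mul_re] at hre ⊢
    rw [hre]
    exact intervalIntegral.integral_congr fun t _ => by ring
  · rw [← cim]
    simp only [map_sub, map_add, RCLike.mul_im] at him ⊢
    rw [him]
    exact intervalIntegral.integral_congr fun t _ => by ring

theorem IsPrimitive.normSq {u v : ℝ → 𝕜} (h : IsPrimitive u v) :
    IsPrimitive (fun x => ‖u x‖ ^ 2) (fun x => 2 * RCLike.re (starRingEnd 𝕜 (u x) * v x)) := by
  have := (h.mul h.conj).re
  convert this using 1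
  · funext x
    rw [RCLike.mul_conj]
    norm_cast
  · funext x
    simp only [map_add, RCLike.mul_re, RCLike.conj_re, RCLike.conj_im]
    ring

theorem IsPrimitive.of_contDiff {φ : ℝ → ℝ} (hφ : ContDiff ℝ 1 φ) : IsPrimitive φ (deriv φ) :=
  ⟨(hφ.continuous_deriv le_rfl).locallyIntegrable, fun x y =>
    (intervalIntegral.integral_deriv_eq_sub
      (fun t _ => hφ.differentiable one_ne_zero t)
      ((hφ.continuous_deriv le_rfl).intervalIntegrable x y)).symm⟩

theorem IsWeakDeriv.congr {Ω : Set ℝ} {f f' g g' : ℝ → 𝕜} (h : IsWeakDeriv Ω f f')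
    (hf : f =ᵐ[volume.restrict Ω] g) (hf' : f' =ᵐ[volume.restrict Ω] g') :
    IsWeakDeriv Ω g g' := by
  have key : ∀ {k l : ℝ → 𝕜}, k =ᵐ[volume.restrict Ω] l → LocallyIntegrableOn k Ω volume →
      LocallyIntegrableOn l Ω volume := by
    intro k l hkl hk x hx
    obtain ⟨U, hU, hi⟩ := hk x hx
    refine ⟨U ∩ Ω, inter_mem hU self_mem_nhdsWithin, ?_⟩
    exact (hi.mono_set inter_subset_left).congr_fun_ae
      (ae_restrict_of_ae_restrict_of_subset inter_subset_right hkl)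
  refine ⟨key hf h.1, key hf' h.2.1, fun φ h1 h2 h3 => ?_⟩
  have e1 : ∫ x in Ω, deriv φ x • g x = ∫ x in Ω, deriv φ x • f x :=
    integral_congr_ae (hf.mono fun x hx => by simp only [hx])
  have e2 : ∫ x in Ω, φ x • g' x = ∫ x in Ω, φ x • f' x :=
    integral_congr_ae (hf'.mono fun x hx => by simp only [hx])
  rw [e1, e2, h.2.2 φ h1 h2 h3]

/-- Integrate the derivative of φu over an interval at whose ends φ vanishes. -/
theorem IsPrimitive.integral_smul_eq_neg {u v : ℝ → 𝕜} (h : IsPrimitive u v) {φ : ℝ → ℝ}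
    (hφ : ContDiff ℝ ∞ φ) (hc : HasCompactSupport φ) :
    ∫ x, deriv φ x • u x = - ∫ x, φ x • v x := by
  obtain ⟨R, hR, hsub⟩ := hc.isCompact.isBounded.subset_ball_lt 0 0
  rw [Real.ball_eq_Ioo, zero_sub, zero_add] at hsub
  have hφ1 : ContDiff ℝ 1 φ := hφ.of_le (by exact_mod_cast le_top)
  have z : ∀ x, x ∉ Ioo (-R) R → φ x = 0 ∧ deriv φ x = 0 := fun x hx =>
    ⟨image_eq_zero_of_notMem_tsupport fun h' => hx (hsub h'),
      image_eq_zero_of_notMem_tsupport fun h' => hx (hsub (tsupport_deriv_subset h'))⟩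
  have s1 : Function.support (fun x => deriv φ x • u x) ⊆ Ioc (-R) R := fun x hx => by
    by_contra hn
    exact hx (by simp [(z x fun h' => hn (Ioo_subset_Ioc_self h')).2])
  have s2 : Function.support (fun x => φ x • v x) ⊆ Ioc (-R) R := fun x hx => by
    by_contra hn
    exact hx (by simp [(z x fun h' => hn (Ioo_subset_Ioc_self h')).1])
  rw [← intervalIntegral.integral_eq_integral_of_support_subset s1,
    ← intervalIntegral.integral_eq_integral_of_support_subset s2, eq_neg_iff_add_eq_zero,
    ← intervalIntegral.integral_add]
  · have := ((IsPrimitive.ofReal (𝕜 := 𝕜) (IsPrimitive.of_contDiff hφ1)).mul h).2 (-R) R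
    simp only [(z R (by simp)).1, (z (-R) (by simp)).1] at this
    simp only [RCLike.real_smul_eq_coe_mul]
    rw [← this]
    simp
  · exact ((hφ1.continuous_deriv le_rfl).smul h.continuous).intervalIntegrable _ _
  · exact (h.1.intervalIntegrable _ _).continuousOn_smul hφ.continuous.continuousOn

theorem setIntegral_smul_eq_integral_of_tsupport_subset {Ω : Set ℝ} {φ : ℝ → ℝ}
    (hs : tsupport φ ⊆ Ω) (u : ℝ → 𝕜) : ∫ x in Ω, φ x • u x = ∫ x, φ x • u x := by
  refine setIntegral_eq_integral_of_forall_compl_eq_zero fun x hx => ?_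
  have : φ x = 0 := image_eq_zero_of_notMem_tsupport (fun h' => hx (hs h'))
  simp [this]

theorem IsPrimitive.isWeakDeriv {u v : ℝ → 𝕜} (h : IsPrimitive u v) (Ω : Set ℝ) :
    IsWeakDeriv Ω u v := by
  refine ⟨h.continuous.locallyIntegrable.locallyIntegrableOn Ω, h.1.locallyIntegrableOn Ω,
    fun φ hφ hc hs => ?_⟩
  rw [setIntegral_smul_eq_integral_of_tsupport_subset hs,
    setIntegral_smul_eq_integral_of_tsupport_subset (tsupport_deriv_subset.trans hs),
    h.integral_smul_eq_neg hφ hc]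

/-- Uniqueness of the weak derivative frees the norm from the chosen representative, so any explicit
derivative computes it. -/
theorem IsWeakDeriv.h1Norm_eq {Ω : Set ℝ} (hΩ : IsOpen Ω) {f f' : ℝ → 𝕜}
    (h : IsWeakDeriv Ω f f') :
    h1Norm Ω f = Real.sqrt ((∫ x in Ω, ‖f x‖ ^ 2) + ∫ x in Ω, ‖f' x‖ ^ 2) := by
  have hw : IsWeakDeriv Ω f (weakDeriv Ω f) := by
    have hex : ∃ f', IsWeakDeriv Ω f f' := ⟨f', h⟩
    rw [weakDeriv, dif_pos hex]
    exact hex.choose_spec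
  rw [h1Norm]
  congr 2
  exact integral_congr_ae ((hw.ae_eq hΩ h).mono fun x hx => by simp only [hx])

end IsPrimitive

/-! ### The du Bois-Reymond lemma: a weak derivative yields an absolutely continuous representative
-/

section DuBoisReymond

variable {𝕜 : Type*} [RCLike 𝕜]

theorem LocallyIntegrableOn.integrable_smul_of_tsupport_subset {Ω : Set ℝ} {k : ℝ → 𝕜}
    (hk : LocallyIntegrableOn k Ω volume) {φ : ℝ → ℝ} (hφ : Continuous φ)
    (hc : HasCompactSupport φ) (hs : tsupport φ ⊆ Ω) :
    Integrable (fun x => φ x • k x) volume := by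
  rw [← integrableOn_iff_integrable_of_support_subset (s := tsupport φ)]
  · exact (hk.integrableOn_compact_subset hs hc).continuousOn_smul hφ.continuousOn hc
  · intro x hx
    apply subset_tsupport
    intro h0
    exact hx (by simp [h0])

/-- A test function on an interval with vanishing integral is the derivative of a test function. -/
theorem exists_deriv_eq_of_integral_eq_zero {Ω : Set ℝ} (hΩ : Ω.OrdConnected) {η : ℝ → ℝ}
    (hη : ContDiff ℝ ∞ η) (hc : HasCompactSupport η) (hs : tsupport η ⊆ Ω) (h0 : ∫ x, η x = 0) :
    ∃ φ : ℝ → ℝ, ContDiff ℝ ∞ φ ∧ HasCompactSupport φ ∧ tsupport φ ⊆ Ω ∧ deriv φ = η := by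
  rcases (tsupport η).eq_empty_or_nonempty with he | hne
  · refine ⟨0, contDiff_const, HasCompactSupport.zero, ?_, ?_⟩
    · simp [tsupport]
    · rw [tsupport_eq_empty_iff.mp he]; simp
  obtain ⟨a, ha, ha'⟩ := hc.isCompact.exists_isLeast hne
  obtain ⟨b, hb, hb'⟩ := hc.isCompact.exists_isGreatest hne
  have hz : ∀ x, x ∉ Icc a b → η x = 0 := fun x hx =>
    image_eq_zero_of_notMem_tsupport fun h => hx ⟨ha' h, hb' h⟩
  set φ : ℝ → ℝ := fun x => ∫ t in a..x, η t with hφ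
  have hd : ∀ x, HasDerivAt φ (η x) x := fun x =>
    intervalIntegral.integral_hasDerivAt_right (hη.continuous.intervalIntegrable _ _)
      hη.continuous.stronglyMeasurable.stronglyMeasurableAtFilter hη.continuous.continuousAt
  have hderiv : deriv φ = η := funext fun x => (hd x).deriv
  have hsupp : Function.support φ ⊆ Icc a b := by
    intro x hx
    by_contra hn
    refine hx ?_
    rcases lt_or_ge x a with h | h
    · refine intervalIntegral.integral_zero_ae ?_
      have : ∀ᵐ t, t ≠ a := by simp [ae_iff, measure_singleton]
      filter_upwards [this] with t ht htm
      rw [uIoc_of_ge h.le] at htm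
      exact hz t fun h' => ht (le_antisymm htm.2 h'.1)
    · have hbx : b < x := by
        by_contra h'
        exact hn ⟨h, not_lt.mp h'⟩
      have hab : a ≤ b := ha' hb
      -- The base point moves to `a - 1` because interval integrals live on half-open intervals
      -- `Ioc`, and `Ioc a x` would omit the endpoint `a`.
      have e1 : φ x = φ x - φ (a - 1) := by
        have : φ (a - 1) = 0 := by
          refine intervalIntegral.integral_zero_ae ?_
          have : ∀ᵐ t, t ≠ a := by simp [ae_iff, measure_singleton]
          filter_upwards [this] with t ht htm
          rw [uIoc_of_ge (by linarith)] at htm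
          exact hz t fun h' => ht (le_antisymm htm.2 h'.1)
        rw [this, sub_zero]
      rw [e1, hφ]
      simp only
      rw [intervalIntegral.integral_interval_sub_left (hη.continuous.intervalIntegrable _ _)
        (hη.continuous.intervalIntegrable _ _),
        intervalIntegral.integral_eq_integral_of_support_subset, h0]
      intro t ht
      by_contra hn'
      exact ht (hz t fun h' => hn' ⟨by linarith [h'.1], by linarith [h'.2]⟩)
  have hts : tsupport φ ⊆ Icc a b := closure_minimal hsupp isClosed_Icc
  refine ⟨φ, ?_, HasCompactSupport.of_support_subset_isCompact isCompact_Icc hsupp,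
    hts.trans (hΩ.out (hs ha) (hs hb)), hderiv⟩
  rw [contDiff_infty_iff_deriv, hderiv]
  exact ⟨fun x => (hd x).differentiableAt, hη⟩

/-- With ψ a bump of integral 1, φ - (∫φ)ψ has integral zero, so it is the derivative of a test
function and f annihilates it. Hence ∫φf = (∫φ)(∫ψf) for all φ, and the constant is ∫ψf. -/
theorem IsWeakDeriv.ae_eq_const_of_zero {Ω : Set ℝ} (hΩ : IsOpen Ω) (hc : Ω.OrdConnected)
    {f : ℝ → 𝕜} (h : IsWeakDeriv Ω f 0) : ∃ c : 𝕜, f =ᵐ[volume.restrict Ω] fun _ => c := by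
  rcases Ω.eq_empty_or_nonempty with he | ⟨x₀, hx₀⟩
  · exact ⟨0, by rw [he, Measure.restrict_empty, ae_zero]; exact eventually_bot⟩
  obtain ⟨ψ₀, hψs, hψc, hψ, hψr, hψ1⟩ :=
    exists_contDiff_tsupport_subset (n := ⊤) (hΩ.mem_nhds hx₀)
  have hψpos : 0 < ∫ x, ψ₀ x := by
    have hcont : Continuous ψ₀ := hψ.continuous
    refine (integral_pos_iff_support_of_nonneg (fun x => (hψr ⟨x, rfl⟩).1)
      (hcont.integrable_of_hasCompactSupport hψc)).mpr ?_
    exact hcont.isOpen_support.measure_pos _ ⟨x₀, by simp [hψ1]⟩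
  set I := ∫ x, ψ₀ x with hI
  set ψ : ℝ → ℝ := fun x => I⁻¹ * ψ₀ x with hψdef
  have ψsm : ContDiff ℝ ∞ ψ := contDiff_const.mul hψ
  have ψcs : HasCompactSupport ψ := hψc.mul_left
  have ψts : tsupport ψ ⊆ Ω := (tsupport_mul_subset_right).trans hψs
  have ψint : ∫ x, ψ x = 1 := by
    rw [hψdef, integral_const_mul, ← hI, inv_mul_cancel₀ hψpos.ne']
  set c : 𝕜 := ∫ x, ψ x • f x with hcdef
  refine ⟨c, ?_⟩
  have hloc : LocallyIntegrableOn (fun x => f x - c) Ω volume :=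
    h.1.sub (continuous_const.locallyIntegrable.locallyIntegrableOn Ω)
  have key : ∀ᵐ x ∂(volume : Measure ℝ), x ∈ Ω → f x - c = 0 := by
    refine hΩ.ae_eq_zero_of_integral_contDiff_smul_eq_zero hloc ?_
    intro φ hφ hφc hφs
    set J := ∫ x, φ x with hJ
    have hsub : tsupport (fun x => φ x - J * ψ x) ⊆ Ω := by
      refine (tsupport_sub _ _).trans (union_subset hφs ?_)
      exact (tsupport_mul_subset_right (f := fun _ => J)).trans ψts
    have ηc : HasCompactSupport (fun x => φ x - J * ψ x) := hφc.sub ψcs.mul_left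
    have iφ : Integrable φ volume := hφ.continuous.integrable_of_hasCompactSupport hφc
    have iψ : Integrable ψ volume := ψsm.continuous.integrable_of_hasCompactSupport ψcs
    obtain ⟨Φ, hΦ, hΦc, hΦs, hΦd⟩ := exists_deriv_eq_of_integral_eq_zero hc
      (hφ.sub (contDiff_const.mul ψsm)) ηc hsub
      (by
        rw [integral_sub iφ (iψ.const_mul J), integral_const_mul, ψint]
        simp [hJ])
    have hw := h.2.2 Φ hΦ hΦc hΦs
    rw [setIntegral_smul_eq_integral_of_tsupport_subset
      (tsupport_deriv_subset.trans hΦs), hΦd] at hw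
    have i1 := LocallyIntegrableOn.integrable_smul_of_tsupport_subset h.1 hφ.continuous hφc hφs
    have i2 := LocallyIntegrableOn.integrable_smul_of_tsupport_subset h.1 ψsm.continuous ψcs ψts
    have e : ∫ x, (φ x - J * ψ x) • f x = (∫ x, φ x • f x) - J • c := by
      rw [hcdef, ← integral_smul]
      refine Eq.trans ?_ (integral_sub i1 (i2.smul J))
      exact integral_congr_ae (.of_forall fun x => by simp only [sub_smul, mul_smul])
    rw [e] at hw
    simp only [Pi.zero_apply, smul_zero, integral_zero, neg_zero] at hw
    simp only [smul_sub]
    rw [integral_sub i1 (iφ.smul_const c), integral_smul_const, ← hJ, hw]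
  rw [Filter.EventuallyEq, ae_restrict_iff' hΩ.measurableSet]
  filter_upwards [key] with x hx hxΩ
  exact sub_eq_zero.mp (hx hxΩ)

theorem IsWeakDeriv.sub {Ω : Set ℝ} {f f' g g' : ℝ → 𝕜} (h : IsWeakDeriv Ω f f')
    (hg : IsWeakDeriv Ω g g') :
    IsWeakDeriv Ω (fun x => f x - g x) (fun x => f' x - g' x) := by
  refine ⟨h.1.sub hg.1, h.2.1.sub hg.2.1, fun φ hφ hc hs => ?_⟩
  have hφ1 : ContDiff ℝ 1 φ := hφ.of_le (by exact_mod_cast le_top)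
  have dc : Continuous (deriv φ) := hφ1.continuous_deriv le_rfl
  have ds : tsupport (deriv φ) ⊆ Ω := tsupport_deriv_subset.trans hs
  simp only [smul_sub]
  rw [integral_sub, integral_sub, h.2.2 φ hφ hc hs, hg.2.2 φ hφ hc hs]
  · ring
  · exact (LocallyIntegrableOn.integrable_smul_of_tsupport_subset h.2.1 hφ.continuous hc
      hs).integrableOn
  · exact (LocallyIntegrableOn.integrable_smul_of_tsupport_subset hg.2.1 hφ.continuous hc
      hs).integrableOn
  · exact (LocallyIntegrableOn.integrable_smul_of_tsupport_subset h.1 dc hc.deriv ds).integrableOn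
  · exact (LocallyIntegrableOn.integrable_smul_of_tsupport_subset hg.1 dc hc.deriv
      ds).integrableOn

/-- A function on an open interval whose weak derivative `v` is locally integrable on the line
agrees almost everywhere on the interval with a primitive of `v`. -/
theorem IsWeakDeriv.exists_isPrimitive {Ω : Set ℝ} (hΩ : IsOpen Ω) (hc : Ω.OrdConnected)
    {f v : ℝ → 𝕜} (h : IsWeakDeriv Ω f v) (hv : LocallyIntegrable v volume) :
    ∃ u : ℝ → 𝕜, IsPrimitive u v ∧ f =ᵐ[volume.restrict Ω] u := by
  have h0 := IsPrimitive.of_locallyIntegrable hv 0 0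
  have hd := h.sub (h0.isWeakDeriv Ω)
  simp only [sub_self] at hd
  obtain ⟨c, hcc⟩ := IsWeakDeriv.ae_eq_const_of_zero hΩ hc hd
  refine ⟨_, IsPrimitive.of_locallyIntegrable hv 0 c, hcc.mono fun x hx => ?_⟩
  simp only [zero_add] at hx
  rw [← hx]; ring

end DuBoisReymond

/-! ### The product inequality on the line with constant 1 -/

section ProductInequality

variable {𝕜 : Type*} [RCLike 𝕜]

/-- Integrability of `q` gives `p` a limit at +∞, and integrability of `p` forces that limit to be
0. -/
theorem IsPrimitive.integral_Ioi_eq_neg {p q : ℝ → ℝ} (h : IsPrimitive p q)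
    (hp : Integrable p volume) (hq : Integrable q volume) (x : ℝ) :
    ∫ t in Ioi x, q t = - p x := by
  have h1 : Tendsto p atTop (𝓝 (p x + ∫ t in Ioi x, q t)) := by
    have e : p = fun y => p x + ∫ t in x..y, q t := by
      funext y
      rw [← h.2]; ring
    have := (intervalIntegral_tendsto_integral_Ioi x hq.integrableOn tendsto_id).const_add (p x)
    simp only [id] at this
    rwa [← e] at this
  have h2 : IntegrableAtFilter p atTop volume := ⟨univ, univ_mem, hp.integrableOn⟩
  have h3 := h2.eq_zero_of_tendsto (fun s hs => by
    obtain ⟨b, hb⟩ := mem_atTop_sets.mp hs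
    rw [← top_le_iff, ← Real.volume_Ici (a := b)]
    exact measure_mono hb) h1
  linarith

theorem IsPrimitive.integral_Iic_eq {p q : ℝ → ℝ} (h : IsPrimitive p q)
    (hp : Integrable p volume) (hq : Integrable q volume) (x : ℝ) :
    ∫ t in Iic x, q t = p x := by
  have h1 : Tendsto p atBot (𝓝 (p x - ∫ t in Iic x, q t)) := by
    have e : p = fun y => p x - ∫ t in y..x, q t := by
      funext y
      rw [← h.2]; ring
    have := (intervalIntegral_tendsto_integral_Iic x hq.integrableOn tendsto_id).const_sub (p x)
    simp only [id] at this
    rwa [← e] at this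
  have h2 : IntegrableAtFilter p atBot volume := ⟨univ, univ_mem, hp.integrableOn⟩
  have h3 := h2.eq_zero_of_tendsto (fun s hs => by
    obtain ⟨b, hb⟩ := mem_atBot_sets.mp hs
    rw [← top_le_iff, ← Real.volume_Iic (a := b)]
    exact measure_mono hb) h1
  linarith

theorem IsPrimitive.integral_eq_zero {p q : ℝ → ℝ} (h : IsPrimitive p q)
    (hp : Integrable p volume) (hq : Integrable q volume) : ∫ t, q t = 0 := by
  rw [← intervalIntegral.integral_Iic_add_Ioi (b := 0) hq.integrableOn hq.integrableOn,
    h.integral_Iic_eq hp hq, h.integral_Ioi_eq_neg hp hq]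
  ring

theorem MeasureTheory.MemLp.integrable_norm_sq {u : ℝ → 𝕜} {μ : Measure ℝ} (hu : MemLp u 2 μ) :
    Integrable (fun x => ‖u x‖ ^ 2) μ :=
  (memLp_two_iff_integrable_sq_norm hu.1).mp hu

theorem abs_two_mul_re_conj_mul_le (z w : 𝕜) :
    |2 * RCLike.re (starRingEnd 𝕜 z * w)| ≤ ‖z‖ ^ 2 + ‖w‖ ^ 2 := by
  have h := RCLike.abs_re_le_norm (starRingEnd 𝕜 z * w)
  rw [norm_mul, RCLike.norm_conj] at h
  rw [abs_mul, abs_two]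
  nlinarith [sq_nonneg (‖z‖ - ‖w‖)]

theorem norm_add_sq_eq_re_conj_mul (z w : 𝕜) :
    ‖z + w‖ ^ 2 = ‖z‖ ^ 2 + ‖w‖ ^ 2 + 2 * RCLike.re (starRingEnd 𝕜 z * w) := by
  simp only [← RCLike.normSq_eq_def', RCLike.normSq_apply, map_add, RCLike.mul_re, RCLike.conj_re,
    RCLike.conj_im]
  ring

theorem MeasureTheory.MemLp.integrable_re_conj_mul {u v : ℝ → 𝕜} (hu : MemLp u 2 volume)
    (hv : MemLp v 2 volume) :
    Integrable (fun x => 2 * RCLike.re (starRingEnd 𝕜 (u x) * v x)) volume := by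
  refine (hu.integrable_norm_sq.add hv.integrable_norm_sq).mono' ?_ (.of_forall fun x => ?_)
  · exact ((RCLike.continuous_re.comp_aestronglyMeasurable
      ((RCLike.continuous_conj.comp_aestronglyMeasurable hu.1).mul hv.1))).const_mul 2
  · exact abs_two_mul_re_conj_mul_le _ _

/-- The cross term of |u + v|² is the derivative of |u|², which integrates to -|u(x)|² over the
half-line. -/
theorem IsPrimitive.integral_Ioi_sq_add_sq {u v : ℝ → 𝕜} (h : IsPrimitive u v)
    (hu : MemLp u 2 volume) (hv : MemLp v 2 volume) (x : ℝ) :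
    ∫ t in Ioi x, (‖u t‖ ^ 2 + ‖v t‖ ^ 2) = ‖u x‖ ^ 2 + ∫ t in Ioi x, ‖u t + v t‖ ^ 2 := by
  have hw := hu.integrable_re_conj_mul hv
  have e := h.normSq.integral_Ioi_eq_neg hu.integrable_norm_sq hw x
  simp only [norm_add_sq_eq_re_conj_mul]
  have e' := integral_add (hu.integrable_norm_sq.add hv.integrable_norm_sq).integrableOn
    (hw.integrableOn (s := Ioi x))
  simp only [Pi.add_apply] at e'
  rw [e', e]
  ring

theorem IsPrimitive.normSq_le_integral_Iio {u v : ℝ → 𝕜} (h : IsPrimitive u v)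
    (hu : MemLp u 2 volume) (hv : MemLp v 2 volume) (x : ℝ) :
    ‖u x‖ ^ 2 ≤ ∫ t in Iio x, (‖u t‖ ^ 2 + ‖v t‖ ^ 2) := by
  have hw := hu.integrable_re_conj_mul hv
  rw [← h.normSq.integral_Iic_eq hu.integrable_norm_sq hw x, integral_Iic_eq_integral_Iio]
  refine integral_mono hw.integrableOn
    (hu.integrable_norm_sq.add hv.integrable_norm_sq).integrableOn fun t => ?_
  exact (le_abs_self _).trans (abs_two_mul_re_conj_mul_le _ _)

/-- A non-sharp Sobolev embedding, used for boundedness and hence integrability of the products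
below. -/
theorem IsPrimitive.normSq_le_integral {u v : ℝ → 𝕜} (h : IsPrimitive u v)
    (hu : MemLp u 2 volume) (hv : MemLp v 2 volume) (x : ℝ) :
    ‖u x‖ ^ 2 ≤ ∫ t, (‖u t‖ ^ 2 + ‖v t‖ ^ 2) :=
  (h.normSq_le_integral_Iio hu hv x).trans
    (setIntegral_le_integral (hu.integrable_norm_sq.add hv.integrable_norm_sq)
      (.of_forall fun t => by simp only [Pi.zero_apply]; positivity))

section Fubini

variable {a p : ℝ → ℝ}

theorem integrable_indicator_lt_mul (ha : Integrable a volume) (hp : Integrable p volume) :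
    Integrable (fun z : ℝ × ℝ => {z : ℝ × ℝ | z.1 < z.2}.indicator (fun z => a z.1 * p z.2) z)
      (volume.prod volume) :=
  (ha.mul_prod hp).indicator (measurableSet_lt measurable_fst measurable_snd)

theorem mul_integral_Ioi_eq (x : ℝ) :
    a x * ∫ y in Ioi x, p y =
      ∫ y, {z : ℝ × ℝ | z.1 < z.2}.indicator (fun z => a z.1 * p z.2) (x, y) := by
  rw [← integral_const_mul, ← integral_indicator measurableSet_Ioi]
  rfl

theorem mul_integral_Iio_eq (y : ℝ) :
    p y * ∫ x in Iio y, a x =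
      ∫ x, {z : ℝ × ℝ | z.1 < z.2}.indicator (fun z => a z.1 * p z.2) (x, y) := by
  rw [← integral_const_mul, ← integral_indicator measurableSet_Iio]
  refine integral_congr_ae (.of_forall fun x => ?_)
  simp only [indicator, mem_Iio, mem_ofPred_eq, mul_comm]

theorem integrable_mul_integral_Ioi (ha : Integrable a volume) (hp : Integrable p volume) :
    Integrable (fun x => a x * ∫ y in Ioi x, p y) volume := by
  simp only [mul_integral_Ioi_eq]
  exact (integrable_indicator_lt_mul ha hp).integral_prod_left

theorem integrable_mul_integral_Iio (ha : Integrable a volume) (hp : Integrable p volume) :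
    Integrable (fun y => p y * ∫ x in Iio y, a x) volume := by
  simp only [mul_integral_Iio_eq]
  exact (integrable_indicator_lt_mul ha hp).integral_prod_right

theorem integral_mul_integral_Ioi (ha : Integrable a volume) (hp : Integrable p volume) :
    ∫ x, a x * ∫ y in Ioi x, p y = ∫ y, p y * ∫ x in Iio y, a x := by
  simp only [mul_integral_Ioi_eq, mul_integral_Iio_eq]
  exact integral_integral_swap (f := fun x y =>
    {z : ℝ × ℝ | z.1 < z.2}.indicator (fun z => a z.1 * p z.2) (x, y))
    (integrable_indicator_lt_mul ha hp)

/-- The two terms are the integrals over the half-planes on either side of the diagonal. -/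
theorem integral_mul_integral_eq_add (ha : Integrable a volume) (hp : Integrable p volume) :
    (∫ x, a x) * ∫ y, p y =
      (∫ x, a x * ∫ y in Ioi x, p y) + ∫ y, p y * ∫ x in Ioi y, a x := by
  rw [integral_mul_integral_Ioi hp ha, ← integral_add (integrable_mul_integral_Ioi ha hp)
    (integrable_mul_integral_Iio hp ha), ← integral_mul_const]
  refine integral_congr_ae (.of_forall fun x => ?_)
  simp only
  rw [← intervalIntegral.integral_Iic_add_Ioi (b := x) hp.integrableOn hp.integrableOn,
    integral_Iic_eq_integral_Iio]
  ring

end Fubini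

variable {u v u' v' : ℝ → 𝕜}

theorem IsPrimitive.integrable_mul_normSq (h : IsPrimitive u v)
    (hu : MemLp u 2 volume) (hv : MemLp v 2 volume) {a : ℝ → ℝ} (ha : Integrable a volume) :
    Integrable (fun x => a x * ‖u x‖ ^ 2) volume :=
  ha.mul_bdd (c := ∫ t, (‖u t‖ ^ 2 + ‖v t‖ ^ 2))
    (h.continuous.norm.pow 2).aestronglyMeasurable (.of_forall fun x => by
    rw [Real.norm_of_nonneg (by positivity)]
    exact h.normSq_le_integral hu hv x)

/-- One half-plane: complete the square in the inner integral, swap the order of integration in the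
remainder, then bound the resulting left half-line integral below by |u|². -/
theorem IsPrimitive.le_integral_mul_integral_Ioi (h : IsPrimitive u v)
    (hu : MemLp u 2 volume) (hv : MemLp v 2 volume) (h' : IsPrimitive u' v')
    (hu' : MemLp u' 2 volume) (hv' : MemLp v' 2 volume) :
    ∫ x, ((‖u x‖ ^ 2 + ‖v x‖ ^ 2) * ‖u' x‖ ^ 2 + ‖u' x + v' x‖ ^ 2 * ‖u x‖ ^ 2) ≤
      ∫ x, (‖u x‖ ^ 2 + ‖v x‖ ^ 2) * ∫ y in Ioi x, (‖u' y‖ ^ 2 + ‖v' y‖ ^ 2) := by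
  have ha : Integrable (fun x => ‖u x‖ ^ 2 + ‖v x‖ ^ 2) volume :=
    hu.integrable_norm_sq.add hv.integrable_norm_sq
  have hp : Integrable (fun x => ‖u' x + v' x‖ ^ 2) volume :=
    (hu'.add hv').integrable_norm_sq
  have i1 := h'.integrable_mul_normSq hu' hv' ha
  have i2 := h.integrable_mul_normSq hu hv hp
  simp only [h'.integral_Ioi_sq_add_sq hu' hv', mul_add (‖u _‖ ^ 2 + ‖v _‖ ^ 2)]
  rw [integral_add i1 i2, integral_add i1 (integrable_mul_integral_Ioi ha hp),
    integral_mul_integral_Ioi ha hp]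
  refine add_le_add le_rfl (integral_mono i2 (integrable_mul_integral_Iio ha hp) fun x => ?_)
  exact mul_le_mul_of_nonneg_left (h.normSq_le_integral_Iio hu hv x) (by positivity)

/-- The product inequality with constant `1` for square-integrable primitives. -/
theorem IsPrimitive.integral_mul_le (h : IsPrimitive u v)
    (hu : MemLp u 2 volume) (hv : MemLp v 2 volume) (h' : IsPrimitive u' v')
    (hu' : MemLp u' 2 volume) (hv' : MemLp v' 2 volume) :
    ∫ x, (‖u x * u' x‖ ^ 2 + ‖v x * u' x + u x * v' x‖ ^ 2) ≤
      (∫ x, (‖u x‖ ^ 2 + ‖v x‖ ^ 2)) * ∫ x, (‖u' x‖ ^ 2 + ‖v' x‖ ^ 2) := by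
  have ha : Integrable (fun x => ‖u x‖ ^ 2 + ‖v x‖ ^ 2) volume :=
    hu.integrable_norm_sq.add hv.integrable_norm_sq
  have hb : Integrable (fun x => ‖u' x‖ ^ 2 + ‖v' x‖ ^ 2) volume :=
    hu'.integrable_norm_sq.add hv'.integrable_norm_sq
  have hp : Integrable (fun x => ‖u x + v x‖ ^ 2) volume := (hu.add hv).integrable_norm_sq
  have hq : Integrable (fun x => ‖u' x + v' x‖ ^ 2) volume := (hu'.add hv').integrable_norm_sq
  have hw := hu.integrable_re_conj_mul hv
  have hw' := hu'.integrable_re_conj_mul hv'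
  have hW := h.normSq.mul h'.normSq
  have iW : Integrable (fun x => 2 * RCLike.re (starRingEnd 𝕜 (u x) * v x) * ‖u' x‖ ^ 2 +
      ‖u x‖ ^ 2 * (2 * RCLike.re (starRingEnd 𝕜 (u' x) * v' x))) volume :=
    ((h'.integrable_mul_normSq hu' hv' hw).add (h.integrable_mul_normSq hu hv hw')).congr
      (.of_forall fun x => by simp only [Pi.add_apply]; ring)
  have hW0 := hW.integral_eq_zero (h'.integrable_mul_normSq hu' hv' hu.integrable_norm_sq) iW
  have i1 := (h'.integrable_mul_normSq hu' hv' ha).add (h.integrable_mul_normSq hu hv hq)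
  have i2 := (h.integrable_mul_normSq hu hv hb).add (h'.integrable_mul_normSq hu' hv' hp)
  rw [integral_mul_integral_eq_add ha hb]
  refine le_trans ?_ (add_le_add (h.le_integral_mul_integral_Ioi hu hv h' hu' hv')
    (h'.le_integral_mul_integral_Ioi hu' hv' h hu hv))
  refine le_trans ?_ (integral_add i1 i2).le
  -- Subtracting the mean-zero derivative of |u|²|u'|² cancels all cross terms, so a pointwise
  -- inequality suffices.
  have e := integral_sub (i1.add i2) iW
  rw [hW0, sub_zero] at e
  refine le_trans ?_ e.le
  refine integral_mono_of_nonneg (.of_forall fun x => by simp only [Pi.zero_apply]; positivity)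
    ((i1.add i2).sub iW) (.of_forall fun x => ?_)
  simp only [Pi.add_apply, norm_add_sq_eq_re_conj_mul (u x), norm_add_sq_eq_re_conj_mul (u' x)]
  have hn := norm_add_le (v x * u' x) (u x * v' x)
  rw [norm_mul, norm_mul] at hn
  rw [norm_mul]
  have h2 : ‖v x * u' x + u x * v' x‖ ^ 2 ≤ (‖v x‖ * ‖u' x‖ + ‖u x‖ * ‖v' x‖) ^ 2 :=
    pow_le_pow_left₀ (norm_nonneg _) hn 2
  nlinarith [sq_nonneg (‖v x‖ * ‖u' x‖ - ‖u x‖ * ‖v' x‖), sq_nonneg (‖u x‖ * ‖u' x‖)]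

theorem IsPrimitive.memLp_mul (h : IsPrimitive u v) (hu : MemLp u 2 volume)
    (hv : MemLp v 2 volume) {k : ℝ → 𝕜} (hk : MemLp k 2 volume) :
    MemLp (fun x => u x * k x) 2 volume := by
  refine MemLp.of_le_mul (c := Real.sqrt (∫ t, (‖u t‖ ^ 2 + ‖v t‖ ^ 2))) hk
    (h.continuous.aestronglyMeasurable.mul hk.1) (.of_forall fun x => ?_)
  rw [norm_mul]
  exact mul_le_mul_of_nonneg_right (Real.le_sqrt_of_sq_le (h.normSq_le_integral hu hv x))
    (norm_nonneg _)

end ProductInequality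

/-! ### Passage to H¹ and existence of minimal constants -/

section Sobolev

variable {𝕜 : Type*} [RCLike 𝕜] {Ω : Set ℝ} {f u v : ℝ → 𝕜}

theorem IsPrimitive.isWeakDeriv_of_ae_eq (h : IsPrimitive u v)
    (hf : f =ᵐ[volume.restrict Ω] u) : IsWeakDeriv Ω f v :=
  (h.isWeakDeriv Ω).congr hf.symm (ae_eq_refl v)

theorem IsPrimitive.mem_H1 (h : IsPrimitive u v) (hf : f =ᵐ[volume.restrict Ω] u)
    (hu : MemLp u 2 (volume.restrict Ω)) (hv : MemLp v 2 (volume.restrict Ω)) : f ∈ H1 Ω :=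
  ⟨(memLp_congr_ae hf).mpr hu, v, h.isWeakDeriv_of_ae_eq hf, hv⟩

theorem IsPrimitive.h1Norm_sq (h : IsPrimitive u v) (hΩ : IsOpen Ω)
    (hf : f =ᵐ[volume.restrict Ω] u) (hu : MemLp u 2 (volume.restrict Ω))
    (hv : MemLp v 2 (volume.restrict Ω)) :
    h1Norm Ω f ^ 2 = ∫ x in Ω, (‖u x‖ ^ 2 + ‖v x‖ ^ 2) := by
  rw [(h.isWeakDeriv_of_ae_eq hf).h1Norm_eq hΩ, Real.sq_sqrt (by positivity),
    integral_add hu.integrable_norm_sq hv.integrable_norm_sq]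
  congr 1
  exact integral_congr_ae (hf.mono fun x hx => by simp only [hx])

theorem h1Norm_nonneg (Ω : Set ℝ) (f : ℝ → 𝕜) : 0 ≤ h1Norm Ω f := Real.sqrt_nonneg _

theorem exists_isPrimitive_of_mem_H1_univ (hf : f ∈ H1 (𝕜 := 𝕜) univ) :
    ∃ u v : ℝ → 𝕜, IsPrimitive u v ∧ f =ᵐ[volume.restrict univ] u ∧ MemLp u 2 volume ∧
      MemLp v 2 volume := by
  obtain ⟨h2, v, hv, hv2⟩ := hf
  rw [Measure.restrict_univ] at hv2
  obtain ⟨u, hu, hfu⟩ := hv.exists_isPrimitive isOpen_univ ordConnected_univ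
    (hv2.locallyIntegrable one_le_two)
  refine ⟨u, v, hu, hfu, ?_, hv2⟩
  rw [← Measure.restrict_univ (μ := volume)]
  exact (memLp_congr_ae hfu).mp h2

theorem IsPrimitive.memLp_mul_deriv {u' v' : ℝ → 𝕜} (h : IsPrimitive u v)
    (hu : MemLp u 2 volume) (hv : MemLp v 2 volume) (h' : IsPrimitive u' v')
    (hu' : MemLp u' 2 volume) (hv' : MemLp v' 2 volume) :
    MemLp (fun x => v x * u' x + u x * v' x) 2 volume :=
  ((h'.memLp_mul hu' hv' hv).congr_norm
    ((h'.memLp_mul hu' hv' hv).1.congr (.of_forall fun x => mul_comm _ _))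
    (.of_forall fun x => by simp only [mul_comm])).add (h.memLp_mul hu hv hv')

theorem mul_mem_H1_univ {f g : ℝ → 𝕜} (hf : f ∈ H1 (𝕜 := 𝕜) univ)
    (hg : g ∈ H1 (𝕜 := 𝕜) univ) : f * g ∈ H1 (𝕜 := 𝕜) univ := by
  obtain ⟨u, v, h, hfu, hu, hv⟩ := exists_isPrimitive_of_mem_H1_univ hf
  obtain ⟨u', v', h', hgu, hu', hv'⟩ := exists_isPrimitive_of_mem_H1_univ hg
  exact (h.mul h').mem_H1 (hfu.mul hgu)
    ((h.memLp_mul hu hv hu').restrict univ)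
    ((h.memLp_mul_deriv hu hv h' hu' hv').restrict univ)

theorem isProductConstant_one_H1_univ : IsProductConstant univ (H1 (𝕜 := 𝕜) univ) 1 := by
  intro f hf g hg
  obtain ⟨u, v, h, hfu, hu, hv⟩ := exists_isPrimitive_of_mem_H1_univ hf
  obtain ⟨u', v', h', hgu, hu', hv'⟩ := exists_isPrimitive_of_mem_H1_univ hg
  rw [one_mul]
  refine le_of_sq_le_sq ?_ (mul_nonneg (h1Norm_nonneg _ _) (h1Norm_nonneg _ _))
  rw [mul_pow, h.h1Norm_sq isOpen_univ hfu (hu.restrict _) (hv.restrict _),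
    h'.h1Norm_sq isOpen_univ hgu (hu'.restrict _) (hv'.restrict _),
    (h.mul h').h1Norm_sq isOpen_univ (hfu.mul hgu) ((h.memLp_mul hu hv hu').restrict _)
    ((h.memLp_mul_deriv hu hv h' hu' hv').restrict _)]
  simp only [Measure.restrict_univ]
  exact h.integral_mul_le hu hv h' hu' hv'

/-- Each pair f, g imposes a closed condition on C. A function of positive norm, paired with itself,
forces C ≥ 0. -/
theorem isLeast_sInf_isProductConstant {X : Set (ℝ → 𝕜)} (hne : ∃ C, IsProductConstant Ω X C)
    (hX : ∃ f ∈ X, 0 < h1Norm Ω f) :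
    IsLeast {C | IsProductConstant Ω X C} (sInf {C | IsProductConstant Ω X C}) := by
  have hcl : IsClosed {C | IsProductConstant Ω X C} := by
    simp only [IsProductConstant, ofPred_forall]
    refine isClosed_iInter fun f => isClosed_iInter fun _ => isClosed_iInter fun g =>
      isClosed_iInter fun _ => isClosed_le continuous_const ?_
    fun_prop
  have hbdd : BddBelow {C | IsProductConstant Ω X C} := by
    obtain ⟨f, hf, hpos⟩ := hX
    refine ⟨0, fun C hC => ?_⟩
    have := (h1Norm_nonneg Ω (f * f)).trans (hC f hf f hf)
    rw [mul_assoc] at this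
    exact nonneg_of_mul_nonneg_left this (mul_pos hpos hpos)
  exact ⟨hcl.csInf_mem hne hbdd, fun C hC => csInf_le hbdd hC⟩

end Sobolev

/-! ### H¹₀ and extension by zero -/

section ZeroBoundary

variable {a b : ℝ}

/-- Cutting the derivative off outside (a, b) makes its primitive constant on each side, and the
boundary values make these constants zero. The representative thus lives on all of ℝ, where the line
estimates apply. -/
theorem exists_isPrimitive_of_mem_H10 (hab : a < b) {f : ℝ → ℝ} (hf : f ∈ H10 a b) :
    ∃ u v : ℝ → ℝ, IsPrimitive u v ∧ f =ᵐ[volume.restrict (Ioo a b)] u ∧ MemLp u 2 volume ∧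
      MemLp v 2 volume ∧ (∀ x, x ∉ Ioo a b → u x = 0) ∧ ∀ x, x ∉ Ioo a b → v x = 0 := by
  obtain ⟨⟨h2, f', hf', hf'2⟩, w, hw, hfw, hwa, hwb⟩ := hf
  set v := (Ioo a b).indicator f' with hv
  have hvf : f' =ᵐ[volume.restrict (Ioo a b)] v :=
    (indicator_ae_eq_restrict measurableSet_Ioo).symm
  have hv2 : MemLp v 2 volume := (memLp_indicator_iff_restrict measurableSet_Ioo).mpr hf'2
  have hv0 : ∀ x, x ∉ Ioo a b → v x = 0 := fun x hx => indicator_of_notMem hx _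
  obtain ⟨u, hu, hfu⟩ := (hf'.congr (ae_eq_refl f) hvf).exists_isPrimitive isOpen_Ioo
    ordConnected_Ioo (hv2.locallyIntegrable one_le_two)
  have huw : EqOn u w (Icc a b) := by
    refine Measure.eqOn_Icc_of_ae_eq volume hab.ne ?_ hu.continuous.continuousOn hw
    rw [← Measure.restrict_congr_set (Ioo_ae_eq_Icc (μ := volume) (a := a) (b := b))]
    exact hfu.symm.trans hfw
  have hu0 : ∀ x, x ∉ Ioo a b → u x = 0 := by
    intro x hx
    rcases le_or_gt x a with h | h
    · have e := hu.2 x a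
      rw [huw (left_mem_Icc.mpr hab.le), hwa, intervalIntegral.integral_zero_ae
        (.of_forall fun t ht => hv0 t fun h' => ?_)] at e
      · linarith
      · rw [uIoc_of_le h] at ht
        exact absurd ht.2 (not_le.mpr h'.1)
    · have hbx : b ≤ x := not_lt.mp fun h' => hx ⟨h, h'⟩
      have e := hu.2 b x
      rw [huw (right_mem_Icc.mpr hab.le), hwb, intervalIntegral.integral_zero_ae
        (.of_forall fun t ht => hv0 t fun h' => ?_)] at e
      · linarith
      · rw [uIoc_of_le hbx] at ht
        exact absurd ht.1 (not_lt.mpr h'.2.le)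
  refine ⟨u, v, hu, hfu, ?_, hv2, hu0, hv0⟩
  have e : (Ioo a b).indicator u = u :=
    indicator_eq_self.mpr fun x hx => by
      by_contra h
      exact hx (hu0 x h)
  rw [← e]
  exact (memLp_indicator_iff_restrict measurableSet_Ioo).mpr ((memLp_congr_ae hfu).mp h2)

theorem mul_mem_H10 (hab : a < b) {f g : ℝ → ℝ} (hf : f ∈ H10 a b) (hg : g ∈ H10 a b) :
    f * g ∈ H10 a b := by
  obtain ⟨u, v, h, hfu, hu, hv, hu0, -⟩ := exists_isPrimitive_of_mem_H10 hab hf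
  obtain ⟨u', v', h', hgu, hu', hv', -, -⟩ := exists_isPrimitive_of_mem_H10 hab hg
  refine ⟨(h.mul h').mem_H1 (hfu.mul hgu) ((h.memLp_mul hu hv hu').restrict _)
    ((h.memLp_mul_deriv hu hv h' hu' hv').restrict _), fun x => u x * u' x,
    (h.continuous.mul h'.continuous).continuousOn, hfu.mul hgu, ?_, ?_⟩
  · simp [hu0 a (by simp)]
  · simp [hu0 b (by simp)]

/-- The extension by zero of a real function on `(a, b)`, as a complex function. -/
noncomputable def extendZero (a b : ℝ) (f : ℝ → ℝ) : ℝ → ℂ :=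
  fun x => ((Ioo a b).indicator f x : ℝ)

theorem extendZero_mul (f g : ℝ → ℝ) :
    extendZero a b (f * g) = extendZero a b f * extendZero a b g := by
  funext x
  by_cases hx : x ∈ Ioo a b <;> simp [extendZero, hx]

theorem extendZero_mem_H1_and_h1Norm_eq (hab : a < b) {f : ℝ → ℝ} (hf : f ∈ H10 a b) :
    extendZero a b f ∈ H1 (𝕜 := ℂ) univ ∧ h1Norm univ (extendZero a b f) = h1Norm (Ioo a b) f := by
  obtain ⟨u, v, h, hfu, hu, hv, hu0, hv0⟩ := exists_isPrimitive_of_mem_H10 hab hf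
  have hE : extendZero a b f =ᵐ[volume.restrict univ] fun x => (u x : ℂ) := by
    rw [Measure.restrict_univ]
    have := (ae_restrict_iff' measurableSet_Ioo).mp hfu
    filter_upwards [this] with x hx
    by_cases hm : x ∈ Ioo a b
    · simp [extendZero, hm, hx hm]
    · simp [extendZero, hm, hu0 x hm]
  have hC := h.ofReal (𝕜 := ℂ)
  have huC : MemLp (fun x => (u x : ℂ)) 2 volume := hu.ofReal
  have hvC : MemLp (fun x => (v x : ℂ)) 2 volume := hv.ofReal
  refine ⟨hC.mem_H1 hE (huC.restrict _) (hvC.restrict _), ?_⟩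
  rw [← sq_eq_sq₀ (h1Norm_nonneg _ _) (h1Norm_nonneg _ _),
    hC.h1Norm_sq isOpen_univ hE (huC.restrict _) (hvC.restrict _),
    h.h1Norm_sq isOpen_Ioo hfu (hu.restrict _) (hv.restrict _), Measure.restrict_univ,
    setIntegral_eq_integral_of_forall_compl_eq_zero fun x hx => by simp [hu0 x hx, hv0 x hx]]
  simp

theorem IsProductConstant.H10_of_H1_univ (hab : a < b) {C : ℝ}
    (hC : IsProductConstant univ (H1 (𝕜 := ℂ) univ) C) :
    IsProductConstant (Ioo a b) (H10 a b) C := by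
  intro f hf g hg
  obtain ⟨hf1, hf2⟩ := extendZero_mem_H1_and_h1Norm_eq hab hf
  obtain ⟨hg1, hg2⟩ := extendZero_mem_H1_and_h1Norm_eq hab hg
  have := hC _ hf1 _ hg1
  rwa [← extendZero_mul, hf2, hg2,
    (extendZero_mem_H1_and_h1Norm_eq hab (mul_mem_H10 hab hf hg)).2] at this

end ZeroBoundary

/-! ### The tent function -/

section Tent

/-- The tent function on `[0, π]`, with value `1` at `π / 2`. -/
noncomputable def tent (x : ℝ) : ℝ := 1 - |1 - 2 / Real.pi * x|

/-- The derivative of the tent function. -/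
noncomputable def tentDeriv (x : ℝ) : ℝ := if x < Real.pi / 2 then 2 / Real.pi else -(2 / Real.pi)

theorem tent_of_le {x : ℝ} (hx : x ≤ Real.pi / 2) : tent x = 2 / Real.pi * x := by
  have : 2 / Real.pi * x ≤ 1 := by
    rw [div_mul_eq_mul_div, div_le_one Real.pi_pos]; linarith
  rw [tent, abs_of_nonneg (by linarith)]; ring

theorem tent_of_ge {x : ℝ} (hx : Real.pi / 2 ≤ x) : tent x = 2 - 2 / Real.pi * x := by
  have : 1 ≤ 2 / Real.pi * x := by
    rw [div_mul_eq_mul_div, one_le_div Real.pi_pos]; linarith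
  rw [tent, abs_of_nonpos (by linarith)]; ring

theorem continuous_tent : Continuous tent := by
  unfold tent; fun_prop

theorem measurable_tentDeriv : Measurable tentDeriv :=
  Measurable.ite measurableSet_Iio measurable_const measurable_const

theorem abs_tentDeriv (x : ℝ) : |tentDeriv x| = 2 / Real.pi := by
  have : 0 < 2 / Real.pi := div_pos two_pos Real.pi_pos
  unfold tentDeriv
  split_ifs
  · exact abs_of_pos this
  · rw [abs_neg, abs_of_pos this]

theorem hasDerivAt_tent {x : ℝ} (hx : x ≠ Real.pi / 2) : HasDerivAt tent (tentDeriv x) x := by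
  rcases lt_or_gt_of_ne hx with h | h
  · rw [tentDeriv, if_pos h]
    refine HasDerivAt.congr_of_eventuallyEq ?_
      ((eventually_lt_nhds h).mono fun y hy => tent_of_le hy.le)
    simpa using (hasDerivAt_id x).const_mul (2 / Real.pi)
  · rw [tentDeriv, if_neg (not_lt.mpr h.le)]
    refine HasDerivAt.congr_of_eventuallyEq ?_
      ((eventually_gt_nhds h).mono fun y hy => tent_of_ge hy.le)
    simpa using ((hasDerivAt_id x).const_mul (2 / Real.pi)).const_sub 2

theorem isPrimitive_tent : IsPrimitive tent tentDeriv := by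
  have hloc : LocallyIntegrable tentDeriv volume := by
    refine LocallyIntegrable.mono
      (continuous_const (y := 2 / Real.pi)).locallyIntegrable
      measurable_tentDeriv.aestronglyMeasurable (.of_forall fun x => ?_)
    rw [Real.norm_eq_abs, abs_tentDeriv]
    exact le_abs_self _
  refine ⟨hloc, fun x y => (integral_eq_of_hasDerivAt_off_countable _ _
    (countable_singleton (Real.pi / 2)) continuous_tent.continuousOn
    (fun t ht => hasDerivAt_tent ht.2) (hloc.intervalIntegrable x y)).symm⟩

theorem tent_mem_Icc {x : ℝ} (hx : x ∈ Ioo 0 Real.pi) : tent x ∈ Icc (0 : ℝ) 1 := by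
  have hpi := Real.pi_pos
  have h0 : 0 ≤ 2 / Real.pi * x := mul_nonneg (by positivity) hx.1.le
  have h2 : 2 / Real.pi * x ≤ 2 := by
    rw [div_mul_eq_mul_div, div_le_iff₀ hpi]; linarith [hx.2]
  refine ⟨?_, by unfold tent; linarith [abs_nonneg (1 - 2 / Real.pi * x)]⟩
  unfold tent
  have : |1 - 2 / Real.pi * x| ≤ 1 := abs_le.mpr ⟨by linarith, by linarith⟩
  linarith

/-- Each half of (0, π) maps affinely onto (0, 1) and contributes π/2 times the integral. Since the
squared slope is constant, both H¹ norms of the trial function reduce to polynomial integrals on [0,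
1]. -/
theorem integral_comp_tent {G : ℝ → ℝ} (hG : Continuous G) :
    ∫ x in Ioo 0 Real.pi, G (tent x) = Real.pi * ∫ t in (0 : ℝ)..1, G t := by
  have hpi := Real.pi_pos
  have hne : (2 / Real.pi : ℝ) ≠ 0 := by positivity
  have hc : Continuous fun x => G (tent x) := hG.comp continuous_tent
  rw [← integral_Ioc_eq_integral_Ioo, ← intervalIntegral.integral_of_le hpi.le,
    ← intervalIntegral.integral_add_adjacent_intervals (hc.intervalIntegrable 0 (Real.pi / 2))
      (hc.intervalIntegrable (Real.pi / 2) Real.pi)]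
  have e1 : ∫ x in (0 : ℝ)..Real.pi / 2, G (tent x) =
      ∫ x in (0 : ℝ)..Real.pi / 2, G (2 / Real.pi * x) :=
    intervalIntegral.integral_congr fun x hx => by
      rw [uIcc_of_le (by positivity)] at hx
      simp only [tent_of_le hx.2]
  have e2 : ∫ x in (Real.pi / 2)..Real.pi, G (tent x) =
      ∫ x in (Real.pi / 2)..Real.pi, G (2 - 2 / Real.pi * x) :=
    intervalIntegral.integral_congr fun x hx => by
      rw [uIcc_of_le (by linarith)] at hx
      simp only [tent_of_ge hx.1]
  rw [e1, e2, intervalIntegral.integral_comp_mul_left G hne,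
    intervalIntegral.integral_comp_sub_mul G hne]
  have a1 : 2 / Real.pi * (Real.pi / 2) = 1 := by field_simp
  have a2 : 2 / Real.pi * Real.pi = 2 := by field_simp
  rw [a1, a2]
  norm_num
  ring

end Tent

/-! ### The trial function t + t⁵ and the numerical lower bound -/

section LowerBound

theorem isPrimitive_quintic_tent : IsPrimitive (fun x => tent x + tent x ^ 5)
    (fun x => tentDeriv x * (1 + 5 * tent x ^ 4)) := by
  have h := isPrimitive_tent
  have := h.add (((h.mul h).mul (h.mul h)).mul h)
  convert this using 2 <;> ring

theorem memLp_quintic_tent :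
    MemLp (fun x => tent x + tent x ^ 5) 2 (volume.restrict (Ioo 0 Real.pi)) := by
  refine MemLp.of_bound ?_ 2 ((ae_restrict_mem measurableSet_Ioo).mono fun x hx => ?_)
  · exact isPrimitive_quintic_tent.continuous.aestronglyMeasurable
  · obtain ⟨h0, h1⟩ := tent_mem_Icc hx
    rw [Real.norm_of_nonneg (by positivity)]
    linarith [pow_le_one₀ (n := 5) h0 h1]

theorem memLp_quintic_tent_deriv :
    MemLp (fun x => tentDeriv x * (1 + 5 * tent x ^ 4)) 2 (volume.restrict (Ioo 0 Real.pi)) := by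
  refine MemLp.of_bound ?_ (2 / Real.pi * 6)
    ((ae_restrict_mem measurableSet_Ioo).mono fun x hx => ?_)
  · exact isPrimitive_quintic_tent.1.aestronglyMeasurable.restrict
  · obtain ⟨h0, h1⟩ := tent_mem_Icc hx
    rw [norm_mul, Real.norm_eq_abs, abs_tentDeriv, Real.norm_of_nonneg (by positivity)]
    exact mul_le_mul_of_nonneg_left (by linarith [pow_le_one₀ (n := 4) h0 h1])
      (by have := Real.pi_pos; positivity)

theorem quintic_tent_mem_H10 : (fun x => tent x + tent x ^ 5) ∈ H10 0 Real.pi := by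
  have hpi := Real.pi_pos
  refine ⟨isPrimitive_quintic_tent.mem_H1 (ae_eq_refl _) memLp_quintic_tent
    memLp_quintic_tent_deriv, _, isPrimitive_quintic_tent.continuous.continuousOn,
    ae_eq_refl _, ?_, ?_⟩
  · simp [tent_of_le (show (0 : ℝ) ≤ Real.pi / 2 by positivity)]
  · have : tent Real.pi = 0 := by
      rw [tent_of_ge (by linarith)]; field_simp; ring
    simp [this]

theorem tentDeriv_sq (x : ℝ) : tentDeriv x ^ 2 = 4 / Real.pi ^ 2 := by
  rw [← sq_abs, abs_tentDeriv, div_pow]; norm_num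

theorem h1Norm_quintic_tent_sq :
    h1Norm (Ioo 0 Real.pi) (fun x => tent x + tent x ^ 5) ^ 2 =
      Real.pi * (164 / 231 + 4 / Real.pi ^ 2 * (52 / 9)) := by
  rw [isPrimitive_quintic_tent.h1Norm_sq isOpen_Ioo (ae_eq_refl _) memLp_quintic_tent
    memLp_quintic_tent_deriv]
  -- The two groups of terms are (t + t⁵)² and (1 + 5t⁴)², the latter weighted by the squared slope
  -- 4/π².
  have e := integral_comp_tent (G := fun t => (t ^ 2 + 2 * t ^ 6 + t ^ 10) +
    4 / Real.pi ^ 2 * (1 + 10 * t ^ 4 + 25 * t ^ 8)) (by fun_prop)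
  rw [intervalIntegral.integral_add (Continuous.intervalIntegrable (by fun_prop) _ _)
    (Continuous.intervalIntegrable (by fun_prop) _ _), intervalIntegral.integral_const_mul] at e
  have i1 : ∫ t in (0 : ℝ)..1, (t ^ 2 + 2 * t ^ 6 + t ^ 10) = 164 / 231 := by
    repeat rw [intervalIntegral.integral_add (Continuous.intervalIntegrable (by fun_prop) _ _)
      (Continuous.intervalIntegrable (by fun_prop) _ _)]
    norm_num [integral_pow]
  have i2 : ∫ t in (0 : ℝ)..1, (1 + 10 * t ^ 4 + 25 * t ^ 8) = 52 / 9 := by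
    repeat rw [intervalIntegral.integral_add (Continuous.intervalIntegrable (by fun_prop) _ _)
      (Continuous.intervalIntegrable (by fun_prop) _ _)]
    norm_num [integral_pow]
  rw [i1, i2] at e
  rw [← e]
  refine integral_congr_ae (.of_forall fun x => ?_)
  simp only [Real.norm_eq_abs, sq_abs, mul_pow, tentDeriv_sq]
  ring

theorem h1Norm_quintic_tent_mul_self_sq :
    h1Norm (Ioo 0 Real.pi) ((fun x => tent x + tent x ^ 5) * fun x => tent x + tent x ^ 5) ^ 2 =
      Real.pi * (96688 / 69615 + 4 / Real.pi ^ 2 * (4 * (50672 / 4389))) := by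
  have h := isPrimitive_quintic_tent
  have m1 : MemLp (fun x => (tent x + tent x ^ 5) * (tent x + tent x ^ 5)) 2
      (volume.restrict (Ioo 0 Real.pi)) := by
    refine MemLp.of_le_mul (c := 2) memLp_quintic_tent
      (h.continuous.mul h.continuous).aestronglyMeasurable
      ((ae_restrict_mem measurableSet_Ioo).mono fun x hx => ?_)
    obtain ⟨h0, h1⟩ := tent_mem_Icc hx
    rw [norm_mul]
    refine mul_le_mul_of_nonneg_right ?_ (norm_nonneg _)
    rw [Real.norm_of_nonneg (by positivity)]
    linarith [pow_le_one₀ (n := 5) h0 h1]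
  have m2 : MemLp (fun x => tentDeriv x * (1 + 5 * tent x ^ 4) * (tent x + tent x ^ 5) +
      (tent x + tent x ^ 5) * (tentDeriv x * (1 + 5 * tent x ^ 4))) 2
      (volume.restrict (Ioo 0 Real.pi)) := by
    refine MemLp.of_le_mul (c := 4) memLp_quintic_tent_deriv
      (h.mul h).1.aestronglyMeasurable.restrict
      ((ae_restrict_mem measurableSet_Ioo).mono fun x hx => ?_)
    obtain ⟨h0, h1⟩ := tent_mem_Icc hx
    rw [mul_comm (tent x + tent x ^ 5), ← mul_add, norm_mul, mul_comm (4 : ℝ)]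
    refine mul_le_mul_of_nonneg_left ?_ (norm_nonneg _)
    rw [Real.norm_of_nonneg (by positivity)]
    linarith [pow_le_one₀ (n := 5) h0 h1]
  refine ((h.mul h).h1Norm_sq isOpen_Ioo (ae_eq_refl _) m1 m2).trans ?_
  -- Here they are (t + t⁵)⁴ and 4(t + t⁵)²(1 + 5t⁴)².
  have e := integral_comp_tent (G := fun t =>
    (t ^ 4 + 4 * t ^ 8 + 6 * t ^ 12 + 4 * t ^ 16 + t ^ 20) + 4 / Real.pi ^ 2 *
      (4 * (t ^ 2 + 12 * t ^ 6 + 46 * t ^ 10 + 60 * t ^ 14 + 25 * t ^ 18))) (by fun_prop)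
  rw [intervalIntegral.integral_add (Continuous.intervalIntegrable (by fun_prop) _ _)
    (Continuous.intervalIntegrable (by fun_prop) _ _), intervalIntegral.integral_const_mul,
    intervalIntegral.integral_const_mul] at e
  have i1 : ∫ t in (0 : ℝ)..1, (t ^ 4 + 4 * t ^ 8 + 6 * t ^ 12 + 4 * t ^ 16 + t ^ 20) =
      96688 / 69615 := by
    repeat rw [intervalIntegral.integral_add (Continuous.intervalIntegrable (by fun_prop) _ _)
      (Continuous.intervalIntegrable (by fun_prop) _ _)]
    norm_num [integral_pow]
  have i2 : ∫ t in (0 : ℝ)..1, (t ^ 2 + 12 * t ^ 6 + 46 * t ^ 10 + 60 * t ^ 14 + 25 * t ^ 18) =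
      50672 / 4389 := by
    repeat rw [intervalIntegral.integral_add (Continuous.intervalIntegrable (by fun_prop) _ _)
      (Continuous.intervalIntegrable (by fun_prop) _ _)]
    norm_num [integral_pow]
  rw [i1, i2] at e
  rw [← e]
  refine integral_congr_ae (.of_forall fun x => ?_)
  have e3 : tentDeriv x * (1 + 5 * tent x ^ 4) * (tent x + tent x ^ 5) +
      (tent x + tent x ^ 5) * (tentDeriv x * (1 + 5 * tent x ^ 4)) =
      tentDeriv x * (2 * (1 + 5 * tent x ^ 4) * (tent x + tent x ^ 5)) := by ring
  simp only [Real.norm_eq_abs, sq_abs, e3, mul_pow (tentDeriv x), tentDeriv_sq]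
  ring

theorem h1Norm_quintic_tent_pos :
    0 < h1Norm (Ioo 0 Real.pi) (fun x => tent x + tent x ^ 5) := by
  refine lt_of_le_of_ne (h1Norm_nonneg _ _) fun h => ?_
  have e := h1Norm_quintic_tent_sq
  rw [← h] at e
  have : 0 < Real.pi * (164 / 231 + 4 / Real.pi ^ 2 * (52 / 9)) := by positivity
  linarith

theorem IsProductConstant.lt_of_H10 {C : ℝ}
    (hC : IsProductConstant (Ioo 0 Real.pi) (H10 0 Real.pi) C) : 0.811 < C := by
  by_contra! hle
  have hpi := Real.pi_pos
  have h := hC _ quintic_tent_mem_H10 _ quintic_tent_mem_H10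
  have hpos := h1Norm_quintic_tent_pos
  have h2 := h.trans (mul_le_mul_of_nonneg_right (mul_le_mul_of_nonneg_right hle hpos.le) hpos.le)
  have h3 := pow_le_pow_left₀ (h1Norm_nonneg _ _) h2 2
  rw [h1Norm_quintic_tent_mul_self_sq, mul_assoc, mul_pow, ← sq, h1Norm_quintic_tent_sq] at h3
  -- The factor π² clears denominators, leaving polynomials in π with positive coefficients on both
  -- sides, so two-sided bounds on π decide the comparison.
  have h4 := mul_le_mul_of_nonneg_right h3 (sq_nonneg Real.pi)
  have e1 : Real.pi * (96688 / 69615 + 4 / Real.pi ^ 2 * (4 * (50672 / 4389))) * Real.pi ^ 2 =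
      Real.pi * (96688 / 69615 * Real.pi ^ 2 + 16 * (50672 / 4389)) := by
    field_simp; ring
  have e2 : 0.811 ^ 2 * (Real.pi * (164 / 231 + 4 / Real.pi ^ 2 * (52 / 9))) ^ 2 * Real.pi ^ 2 =
      0.811 ^ 2 * (164 / 231 * Real.pi ^ 2 + 4 * (52 / 9)) ^ 2 := by
    field_simp
  rw [e1, e2] at h4
  have hl := Real.pi_gt_d2
  have hu := Real.pi_lt_d4
  have u2 : Real.pi ^ 2 ≤ 9.87 := by nlinarith
  have l2 : 9.859 ≤ Real.pi ^ 2 := by nlinarith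
  have lhs : 3.14 * (96688 / 69615 * 9.859 + 16 * (50672 / 4389)) ≤
      Real.pi * (96688 / 69615 * Real.pi ^ 2 + 16 * (50672 / 4389)) := by gcongr
  have rhs : 0.811 ^ 2 * (164 / 231 * Real.pi ^ 2 + 4 * (52 / 9)) ^ 2 ≤
      0.811 ^ 2 * (164 / 231 * 9.87 + 4 * (52 / 9)) ^ 2 := by gcongr
  have := lhs.trans (h4.trans rhs)
  norm_num at this

end LowerBound

theorem mainTheorem5 :
    (∀ f ∈ H10 0 Real.pi, ∀ g ∈ H10 0 Real.pi, f * g ∈ H10 0 Real.pi) ∧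
    (∀ f ∈ H1 (𝕜 := ℂ) univ, ∀ g ∈ H1 (𝕜 := ℂ) univ, f * g ∈ H1 (𝕜 := ℂ) univ) ∧
    ∃ L M : ℝ,
      IsLeast {C : ℝ | IsProductConstant (Ioo 0 Real.pi) (H10 0 Real.pi) C} L ∧
      IsLeast {C : ℝ | IsProductConstant univ (H1 (𝕜 := ℂ) univ) C} M ∧
      0.811 < L ∧ L ≤ M ∧ M ≤ 1 := by
  have hone := isProductConstant_one_H1_univ (𝕜 := ℂ)
  have hE := extendZero_mem_H1_and_h1Norm_eq Real.pi_pos quintic_tent_mem_H10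
  have hL := isLeast_sInf_isProductConstant ⟨1, hone.H10_of_H1_univ Real.pi_pos⟩
    ⟨_, quintic_tent_mem_H10, h1Norm_quintic_tent_pos⟩
  have hM := isLeast_sInf_isProductConstant ⟨1, hone⟩
    ⟨_, hE.1, hE.2.symm ▸ h1Norm_quintic_tent_pos⟩
  exact ⟨fun f hf g hg => mul_mem_H10 Real.pi_pos hf hg, fun f hf g hg => mul_mem_H1_univ hf hg,
    _, _, hL, hM, hL.1.lt_of_H10, hL.2 (hM.1.H10_of_H1_univ Real.pi_pos), hM.2 hone⟩
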